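/- A polygon is a cyclic sequence of $n\ge 3$ distinct points (vertices) of the Euclidean plane; its edges are the closed segments joining cyclically consecutive vertices, and its boundary is the union of the edges. It is simple if consecutive edges meet only in their common vertex and non-consecutive edges are disjoint (straight angles at vertices are allowed). The open polygon is the region enclosed by the boundary (the bounded part of its complement), and the closed polygon is the open polygon together with the boundary. Two vertices are visible if the closed segment joining them is contained in the closed polygon. The polygon is in general position if, for every visible pair of distinct vertices not joined by an edge, the open segment between them is contained in the open polygon. It is deflated if the open segments joining two different visible pairs of distinct vertices never intersect. A deformation of a simple polygon $P$ with vertices $v_1,\dots,v_n$ is a choice of continuous maps $t\mapsto v_i^t$ from $[0,1]$ to the plane with $v_i^0=v_i$ such that, for every $t\in[0,1]$, the polygon $P^t$ with vertices $v_1^t,\dots,v_n^t$ is simple. It is monotonic if no two vertices ever become visible: there are no $i,j$ and $0\le s<t\le 1$ such that $v_i^t,v_j^t$ are visible in $P^t$ but $v_i^s,v_j^s$ are not visible in $P^s$. The polygon $P$ is deflatable if it has a monotonic deformation for which $P^1$ is deflated. **Theorem.** There exists a simple polygon in general position that is not deflatable. -/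

import Mathlib

namespace PolygonDeflation

/-- The Euclidean plane. -/
abbrev Plane : Type := EuclideanSpace ℝ (Fin 2)

variable {n : ℕ}

/-- Two vertex indices of an `n`-gon are adjacent if they are cyclically consecutive. -/
def Adjacent (i j : Fin n) : Prop :=
  j = finRotate n i ∨ i = finRotate n j

/-- A simple polygon: at least three vertices, pairwise distinct; consecutive closed edges meet
exactly in their common vertex; non-consecutive closed edges are disjoint.  Edge `i` joins
vertex `i` to the cyclically next vertex.  Straight angles at vertices are allowed. -/
structure IsSimple (P : Polygon Plane n) : Prop where
  three_le : 3 ≤ n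
  injective : Function.Injective P.vertices
  consecutive : ∀ i : Fin n,
    P.edgeSet ℝ i ∩ P.edgeSet ℝ (finRotate n i) = {P (finRotate n i)}
  nonconsecutive : ∀ i j : Fin n, i ≠ j → ¬ Adjacent i j →
    Disjoint (P.edgeSet ℝ i) (P.edgeSet ℝ j)

/-- The open polygon: the points enclosed by the boundary curve, i.e. the union of the bounded
connected components of the complement of the boundary. -/
def openPolygon (P : Polygon Plane n) : Set Plane :=
  {x | x ∉ P.boundary ℝ ∧ Bornology.IsBounded (connectedComponentIn (P.boundary ℝ)ᶜ x)}

/-- The closed polygon: the open polygon together with its boundary. -/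
def closedPolygon (P : Polygon Plane n) : Set Plane :=
  openPolygon P ∪ P.boundary ℝ

/-- Two vertices see each other if the closed segment joining them lies in the closed polygon. -/
def Visible (P : Polygon Plane n) (i j : Fin n) : Prop :=
  segment ℝ (P i) (P j) ⊆ closedPolygon P

/-- General position: for every visible pair of distinct vertices that are not joined by an edge
of the polygon, the open segment joining them lies in the open polygon. -/
def InGeneralPosition (P : Polygon Plane n) : Prop :=
  ∀ i j : Fin n, i ≠ j → ¬ Adjacent i j → Visible P i j →
    openSegment ℝ (P i) (P j) ⊆ openPolygon P

/-- A polygon is deflated if no two distinct edges of its visibility graph intersect; the edges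
of the visibility graph are the open segments joining visible pairs of distinct vertices. -/
def IsDeflated (P : Polygon Plane n) : Prop :=
  ∀ i j k l : Fin n, i ≠ j → k ≠ l → s(i, j) ≠ s(k, l) → Visible P i j → Visible P k l →
    Disjoint (openSegment ℝ (P i) (P j)) (openSegment ℝ (P k) (P l))

/-- A deformation of `P`: a motion of the vertices, continuous in the time `t ∈ [0, 1]`,
starting at `P`, such that the polygon is simple at all times. -/
structure Deformation (P : Polygon Plane n) where
  /-- The polygon at time `t`. -/
  at_time : unitInterval → Polygon Plane n
  continuous_vertex : ∀ i : Fin n, Continuous fun t => at_time t i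
  at_zero : at_time 0 = P
  simple : ∀ t, IsSimple (at_time t)

/-- A deformation is monotonic if no two vertices ever become visible. -/
def Deformation.IsMonotonic {P : Polygon Plane n} (D : Deformation P) : Prop :=
  ¬ ∃ (i j : Fin n) (s t : unitInterval), s < t ∧
    Visible (D.at_time t) i j ∧ ¬ Visible (D.at_time s) i j

/-- A polygon is deflatable if some monotonic deformation of it ends in a deflated polygon. -/
def IsDeflatable (P : Polygon Plane n) : Prop :=
  ∃ D : Deformation P, D.IsMonotonic ∧ IsDeflated (D.at_time 1)

end PolygonDeflation

namespace PolygonDeflation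

open Set

/-! ### Orientation and triangles in the plane -/

/-! In the heptagon the quadrilateral 0456 is strictly convex and both its diagonals 05 and 46 are
visible; they cross, so the polygon is not deflated. The point is that no monotonic deformation can
destroy the convexity of this quadrilateral.

Its side 04 is glued to the triangle 024, whose other two sides carry the ears 012 and 234. At 4 the
angle of 024 together with the angle of either neighbouring triangle exceeds π, and likewise at 0.
If one of these four sums fell to π, three vertices would become collinear and one of the pairs 30,
25, 14, 26 would become visible, which monotonicity forbids. The full angle at 4 or 0 stays below
2π, since otherwise two consecutive edges would overlap. If the quadrilateral became straight at 4
or 0, the bound 2π would force the middle angle plus the ear's angle down to π, which is excluded.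
It cannot become straight at 5 or 6 either: in the triangle 024 the angles at 0 and 4 sum to less
than π, so those of the quadrilateral sum to more than π, too much for a triangle.

Hence the weak inequalities imply the strict ones (`margins_pos_of_nonneg`), the set of good times
is open and closed (`pos_of_pos_of_nonneg`), and the final polygon still has two crossing visible
diagonals (`not_isDeflatable`). Visibility is obtained from two explicit triangulations
(`regionBD_subset`, `regionAC_subset`), invisibility from unbounded wedges outside the polygon, so
the Jordan curve theorem is not needed. -/

/-- Twice the signed area of the triangle `p q r`; positive if it is counterclockwise. -/
def turn (p q r : Plane) : ℝ :=
  (q 0 - p 0) * (r 1 - p 1) - (q 1 - p 1) * (r 0 - p 0)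

lemma turn_rotate (p q r : Plane) : turn q r p = turn p q r := by
  unfold turn; ring

lemma continuous_turn (p q : Plane) : Continuous (turn p q) := by
  unfold turn; fun_prop

/-- The closed triangle with counterclockwise vertices `p`, `q`, `r`. -/
def tri (p q r : Plane) : Set Plane :=
  {x | 0 ≤ turn p q x ∧ 0 ≤ turn q r x ∧ 0 ≤ turn r p x}

lemma tri_rotate (p q r : Plane) : tri q r p = tri p q r := by
  ext x; simp only [tri, mem_ofPred_eq]; tauto

lemma isClosed_tri (p q r : Plane) : IsClosed (tri p q r) :=
  (isClosed_le continuous_const (continuous_turn p q)).inter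
    ((isClosed_le continuous_const (continuous_turn q r)).inter
      (isClosed_le continuous_const (continuous_turn r p)))

lemma turn_combo (p q x y : Plane) {a b : ℝ} (hab : a + b = 1) :
    turn p q (a • x + b • y) = a * turn p q x + b * turn p q y := by
  obtain rfl : b = 1 - a := by linarith
  simp only [turn, PiLp.add_apply, PiLp.smul_apply, smul_eq_mul]; ring

lemma convex_tri (p q r : Plane) : Convex ℝ (tri p q r) := by
  rintro x ⟨hx1, hx2, hx3⟩ y ⟨hy1, hy2, hy3⟩ a b ha hb hab
  refine ⟨?_, ?_, ?_⟩ <;> rw [turn_combo _ _ _ _ hab] <;> positivity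

lemma left_mem_tri {p q r : Plane} (h : 0 < turn p q r) : p ∈ tri p q r := by
  refine ⟨?_, ?_, ?_⟩
  · simp [turn]
  · rw [turn_rotate]; exact h.le
  · have : turn r p p = 0 := by unfold turn; ring
    exact this.ge

lemma segment_subset_tri {p q r : Plane} (h : 0 < turn p q r) : segment ℝ p q ⊆ tri p q r := by
  refine (convex_tri p q r).segment_subset (left_mem_tri h) ?_
  rw [← tri_rotate]
  exact left_mem_tri (by rwa [turn_rotate])

lemma turn_add_turn_add_turn (p q r x : Plane) :
    turn p q x + turn q r x + turn r p x = turn p q r := by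
  unfold turn; ring

lemma eq_barycentric {p q r : Plane} (h : turn p q r ≠ 0) (x : Plane) :
    x = (turn q r x / turn p q r) • p + (turn r p x / turn p q r) • q +
      (turn p q x / turn p q r) • r := by
  ext i
  fin_cases i <;> simp <;> field_simp <;> unfold turn <;> ring

lemma isBounded_tri {p q r : Plane} (h : 0 < turn p q r) : Bornology.IsBounded (tri p q r) := by
  refine Bornology.IsBounded.subset
    ((isBounded_convexHull (s := ({p, q, r} : Set Plane))).2 (toFinite _).isBounded) ?_
  rintro x ⟨h1, h2, h3⟩
  rw [eq_barycentric h.ne' x]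
  have hs : turn q r x / turn p q r + turn r p x / turn p q r + turn p q x / turn p q r = 1 := by
    rw [← turn_add_turn_add_turn p q r x] at h ⊢
    field_simp; ring
  rw [convexHull_insert (by simp), convexHull_pair]
  -- The case of coefficient 1 at `p` is separate because the point of the opposite side is
  -- otherwise normalised by the sum of the other two coefficients.
  by_cases h0 : turn q r x / turn p q r = 1
  · have h4 : 0 ≤ turn r p x / turn p q r := by positivity
    have h5 : 0 ≤ turn p q x / turn p q r := by positivity
    rw [h0, show turn r p x / turn p q r = 0 by linarith,
      show turn p q x / turn p q r = 0 by linarith]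
    simp only [one_smul, zero_smul, add_zero, mem_convexJoin, mem_singleton_iff, exists_eq_left]
    exact ⟨q, left_mem_segment ℝ q r, left_mem_segment ℝ p q⟩
  · simp only [mem_convexJoin, mem_singleton_iff, exists_eq_left]
    set a := turn q r x / turn p q r
    set b := turn r p x / turn p q r
    set c := turn p q x / turn p q r
    have ha : 0 ≤ a := by positivity
    have hb : 0 ≤ b := by positivity
    have hc : 0 ≤ c := by positivity
    have hbc : b + c ≠ 0 := fun h => h0 (by linarith)
    refine ⟨(b / (b + c)) • q + (c / (b + c)) • r,
      ⟨b / (b + c), c / (b + c), by positivity, by positivity, by field_simp, rfl⟩,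
      ⟨a, b + c, ha, by positivity, by linarith, ?_⟩⟩
    rw [smul_add, smul_smul, smul_smul, mul_div_cancel₀ _ hbc, mul_div_cancel₀ _ hbc, add_assoc]

lemma mem_segment_of_turn_eq_zero {p q r x : Plane} (h : 0 < turn p q r) (hx : x ∈ tri p q r)
    (h0 : turn p q x = 0) : x ∈ segment ℝ p q := by
  obtain ⟨-, h2, h3⟩ := hx
  refine ⟨turn q r x / turn p q r, turn r p x / turn p q r, by positivity, by positivity, ?_, ?_⟩
  · rw [← turn_add_turn_add_turn p q r x, h0] at h ⊢
    field_simp; ring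
  · conv_rhs => rw [eq_barycentric h.ne' x, h0]
    simp

lemma mem_side_or_mem_interior_tri {p q r x : Plane} (h : 0 < turn p q r) (hx : x ∈ tri p q r) :
    x ∈ segment ℝ p q ∨ x ∈ segment ℝ q r ∨ x ∈ segment ℝ r p ∨ x ∈ interior (tri p q r) := by
  rcases hx.1.eq_or_lt with h1 | h1
  · exact .inl (mem_segment_of_turn_eq_zero h hx h1.symm)
  rcases hx.2.1.eq_or_lt with h2 | h2
  · exact .inr (.inl (mem_segment_of_turn_eq_zero (by rwa [turn_rotate])
      (by rwa [tri_rotate]) h2.symm))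
  rcases hx.2.2.eq_or_lt with h3 | h3
  · exact .inr (.inr (.inl (mem_segment_of_turn_eq_zero (by rwa [← turn_rotate])
      (by rwa [← tri_rotate]) h3.symm)))
  refine .inr (.inr (.inr (mem_interior.2 ⟨{x | 0 < turn p q x} ∩ ({x | 0 < turn q r x} ∩
    {x | 0 < turn r p x}), fun y hy => ⟨hy.1.le, hy.2.1.le, hy.2.2.le⟩, ?_, h1, h2, h3⟩)))
  exact (isOpen_lt continuous_const (continuous_turn p q)).inter
    ((isOpen_lt continuous_const (continuous_turn q r)).inter
      (isOpen_lt continuous_const (continuous_turn r p)))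

lemma turn_pos_of_mem_openSegment {p q r x : Plane} (h : 0 < turn p q r)
    (hx : x ∈ openSegment ℝ p q) : 0 < turn q r x ∧ 0 < turn r p x := by
  obtain ⟨a, b, ha, hb, hab, rfl⟩ := hx
  have e1 : turn q r q = 0 := by unfold turn; ring
  have e2 : turn r p p = 0 := by unfold turn; ring
  rw [turn_combo _ _ _ _ hab, turn_combo _ _ _ _ hab, e1, e2, turn_rotate p q r,
    ← turn_rotate r p q]
  constructor <;> simp <;> positivity

/-- A common side of two triangles on different sides of it is interior to their union. -/
lemma mem_interior_tri_union_tri {p q r s x : Plane} (hr : 0 < turn p q r) (hs : 0 < turn q p s)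
    (hx : x ∈ segment ℝ p q) (hp : x ≠ p) (hq : x ≠ q) :
    x ∈ interior (tri p q r ∪ tri q p s) := by
  have hx' := mem_openSegment_of_ne_left_right hp.symm hq.symm hx
  have hx'' : x ∈ openSegment ℝ q p := by rwa [openSegment_symm]
  obtain ⟨h1, h2⟩ := turn_pos_of_mem_openSegment hr hx'
  obtain ⟨h3, h4⟩ := turn_pos_of_mem_openSegment hs hx''
  refine mem_interior.2 ⟨({x | 0 < turn q r x} ∩ {x | 0 < turn r p x}) ∩
    ({x | 0 < turn p s x} ∩ {x | 0 < turn s q x}), fun y hy => ?_, ?_, ⟨h1, h2⟩, h3, h4⟩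
  · have hy' : turn q p y = - turn p q y := by unfold turn; ring
    rcases le_total 0 (turn p q y) with h | h
    · exact .inl ⟨h, hy.1.1.le, hy.1.2.le⟩
    · exact .inr ⟨by linarith, hy.2.1.le, hy.2.2.le⟩
  · exact ((isOpen_lt continuous_const (continuous_turn q r)).inter
      (isOpen_lt continuous_const (continuous_turn r p))).inter
      ((isOpen_lt continuous_const (continuous_turn p s)).inter
      (isOpen_lt continuous_const (continuous_turn s q)))

/-! ### Interior and exterior of a polygon -/

section

variable {n : ℕ} {P : Polygon Plane n}

/-- The hypothesis puts the frontier of `K` inside the boundary curve, so a connected set avoiding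
the curve cannot leave `K`; its component is therefore bounded. -/
lemma mem_openPolygon_of_frontier_subset {K : Set Plane} (hb : Bornology.IsBounded K)
    (hc : IsClosed K) (h : ∀ x ∈ K, x ∉ P.boundary ℝ → x ∈ interior K) {x : Plane} (hx : x ∈ K)
    (hxP : x ∉ P.boundary ℝ) : x ∈ openPolygon P := by
  refine ⟨hxP, hb.subset ?_⟩
  refine (?_ : _ ⊆ interior K).trans interior_subset
  refine isPreconnected_connectedComponentIn.subset_left_of_subset_union isOpen_interior
    hc.isOpen_compl ?_ ?_ ⟨x, mem_connectedComponentIn hxP, h x hx hxP⟩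
  · exact disjoint_compl_right.mono_left interior_subset
  · intro y hy
    by_cases hyK : y ∈ K
    · exact .inl (h y hyK (connectedComponentIn_subset _ _ hy))
    · exact .inr hyK

lemma subset_closedPolygon {K : Set Plane} (hb : Bornology.IsBounded K)
    (hc : IsClosed K) (h : ∀ x ∈ K, x ∉ P.boundary ℝ → x ∈ interior K) : K ⊆ closedPolygon P := by
  intro x hx
  by_cases hxP : x ∈ P.boundary ℝ
  · exact .inr hxP
  · exact .inl (mem_openPolygon_of_frontier_subset hb hc h hx hxP)

/-- Any point of `W` off the curve has all of `W` in its component, which is thus unbounded. -/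
lemma disjoint_closedPolygon {W : Set Plane} (hW : IsPreconnected W)
    (hb : ¬ Bornology.IsBounded W) (h : Disjoint W (P.boundary ℝ)) :
    Disjoint W (closedPolygon P) := by
  rw [Set.disjoint_left] at h ⊢
  rintro x hx (hxP | hxP)
  · exact hb (hxP.2.subset (hW.subset_connectedComponentIn hx fun y hy => h hy))
  · exact h hx hxP

lemma segment_subset_boundary (P : Polygon Plane n) (i : Fin n) :
    segment ℝ (P i) (P (finRotate n i)) ⊆ P.boundary ℝ := by
  rw [← affineSegment_eq_segment]
  exact subset_iUnion (P.edgeSet ℝ) i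

lemma Visible.symm {i j : Fin n} (h : Visible P i j) : Visible P j i := by
  rwa [Visible, segment_symm]

lemma visible_finRotate (P : Polygon Plane n) (i : Fin n) : Visible P i (finRotate n i) :=
  (segment_subset_boundary P i).trans subset_union_right

lemma Visible.trans_of_mem_segment {i j k : Fin n} (hij : Visible P i j) (hjk : Visible P j k)
    (h : P j ∈ segment ℝ (P i) (P k)) : Visible P i k := by
  have : segment ℝ (P i) (P k) ⊆ segment ℝ (P i) (P j) ∪ segment ℝ (P j) (P k) := by
    rw [← insert_endpoints_openSegment, insert_subset_iff, insert_subset_iff]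
    refine ⟨.inl (left_mem_segment ℝ _ _), .inr (right_mem_segment ℝ _ _), ?_⟩
    refine (openSegment_subset_union _ _ (z := P j) ?_).trans ?_
    · rw [segment_eq_image_lineMap] at h
      exact image_subset_range _ _ h
    · exact insert_subset (.inl (right_mem_segment ℝ _ _))
        (union_subset_union (openSegment_subset_segment ℝ _ _) (openSegment_subset_segment ℝ _ _))
  exact this.trans (union_subset hij hjk)

end

/-! ### Two triangulations of a heptagon -/

section

variable {P : Polygon Plane 7}

lemma segment_subset_boundary_heptagon (P : Polygon Plane 7) :
    segment ℝ (P 0) (P 1) ⊆ P.boundary ℝ ∧ segment ℝ (P 1) (P 2) ⊆ P.boundary ℝ ∧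
    segment ℝ (P 2) (P 3) ⊆ P.boundary ℝ ∧ segment ℝ (P 3) (P 4) ⊆ P.boundary ℝ ∧
    segment ℝ (P 4) (P 5) ⊆ P.boundary ℝ ∧ segment ℝ (P 5) (P 6) ⊆ P.boundary ℝ ∧
    segment ℝ (P 6) (P 0) ⊆ P.boundary ℝ :=
  ⟨segment_subset_boundary P 0, segment_subset_boundary P 1, segment_subset_boundary P 2,
    segment_subset_boundary P 3, segment_subset_boundary P 4, segment_subset_boundary P 5,
    segment_subset_boundary P 6⟩

lemma ne_of_notMem_boundary {x : Plane} (hx : x ∉ P.boundary ℝ) (i : Fin 7) : x ≠ P i := by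
  rintro rfl
  exact hx (segment_subset_boundary P i (left_mem_segment ℝ _ _))

/-- The union of the triangles of the triangulation of a heptagon `P 0, …, P 6` with diagonals
`02`, `24`, `40` and `46`. -/
def regionBD (P : Polygon Plane 7) : Set Plane :=
  tri (P 0) (P 1) (P 2) ∪ (tri (P 2) (P 3) (P 4) ∪ (tri (P 0) (P 2) (P 4) ∪
    (tri (P 0) (P 4) (P 6) ∪ tri (P 4) (P 5) (P 6))))

/-- The union of the triangles of the triangulation of a heptagon `P 0, …, P 6` with diagonals
`02`, `24`, `40` and `50`. -/
def regionAC (P : Polygon Plane 7) : Set Plane :=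
  tri (P 0) (P 1) (P 2) ∪ (tri (P 2) (P 3) (P 4) ∪ (tri (P 0) (P 2) (P 4) ∪
    (tri (P 0) (P 4) (P 5) ∪ tri (P 0) (P 5) (P 6))))

/-- Each side of a triangle is an edge of the polygon or a diagonal with another triangle on its far
side, so the frontier of the union lies on the boundary curve. Only orientations matter: the
triangles need not be known to have disjoint interiors. -/
lemma regionBD_subset (h1 : 0 < turn (P 0) (P 1) (P 2)) (h2 : 0 < turn (P 2) (P 3) (P 4))
    (h3 : 0 < turn (P 0) (P 2) (P 4)) (h4 : 0 < turn (P 0) (P 4) (P 6))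
    (h5 : 0 < turn (P 4) (P 5) (P 6)) :
    regionBD P ⊆ closedPolygon P ∧ ∀ x ∈ regionBD P, x ∉ P.boundary ℝ → x ∈ openPolygon P := by
  have key : Bornology.IsBounded (regionBD P) ∧ IsClosed (regionBD P) ∧
      ∀ x ∈ regionBD P, x ∉ P.boundary ℝ → x ∈ interior (regionBD P) := by
    refine ⟨?_, ?_, fun x hx hxP => ?_⟩
    · exact (isBounded_tri h1).union ((isBounded_tri h2).union ((isBounded_tri h3).union
        ((isBounded_tri h4).union (isBounded_tri h5))))
    · exact (isClosed_tri _ _ _).union ((isClosed_tri _ _ _).union ((isClosed_tri _ _ _).union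
        ((isClosed_tri _ _ _).union (isClosed_tri _ _ _))))
    obtain ⟨s0, s1, s2, s3, s4, s5, s6⟩ := segment_subset_boundary_heptagon P
    have hv := ne_of_notMem_boundary hxP
    have d02 : x ∈ segment ℝ (P 0) (P 2) → x ∈ interior (regionBD P) := fun h => by
      refine interior_mono ?_ (mem_interior_tri_union_tri (r := P 4) (s := P 1) h3
        (by rwa [← turn_rotate]) h (hv 0) (hv 2))
      rw [← tri_rotate (P 2)]; intro y hy; simp only [regionBD, mem_union] at hy ⊢; tauto
    have d24 : x ∈ segment ℝ (P 2) (P 4) → x ∈ interior (regionBD P) := fun h => by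
      refine interior_mono ?_ (mem_interior_tri_union_tri (r := P 0) (s := P 3)
        (by rwa [turn_rotate]) (by rwa [← turn_rotate]) h (hv 2) (hv 4))
      rw [tri_rotate (P 0), ← tri_rotate (P 4)]; intro y hy; simp only [regionBD, mem_union] at hy ⊢; tauto
    have d40 : x ∈ segment ℝ (P 4) (P 0) → x ∈ interior (regionBD P) := fun h => by
      refine interior_mono ?_ (mem_interior_tri_union_tri (r := P 2) (s := P 6)
        (by rwa [← turn_rotate]) h4 h (hv 4) (hv 0))
      rw [← tri_rotate (P 4)]; intro y hy; simp only [regionBD, mem_union] at hy ⊢; tauto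
    have d46 : x ∈ segment ℝ (P 4) (P 6) → x ∈ interior (regionBD P) := fun h => by
      refine interior_mono ?_ (mem_interior_tri_union_tri (r := P 0) (s := P 5)
        (by rwa [turn_rotate]) (by rwa [← turn_rotate]) h (hv 4) (hv 6))
      rw [tri_rotate (P 0), ← tri_rotate (P 6)]; intro y hy; simp only [regionBD, mem_union] at hy ⊢; tauto
    rcases hx with hx | hx | hx | hx | hx
    · rcases mem_side_or_mem_interior_tri h1 hx with h | h | h | h
      · exact absurd (s0 h) hxP
      · exact absurd (s1 h) hxP
      · exact d02 (by rwa [segment_symm])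
      · exact interior_mono (by intro y hy; simp only [regionBD, mem_union] at hy ⊢; tauto) h
    · rcases mem_side_or_mem_interior_tri h2 hx with h | h | h | h
      · exact absurd (s2 h) hxP
      · exact absurd (s3 h) hxP
      · exact d24 (by rwa [segment_symm])
      · exact interior_mono (by intro y hy; simp only [regionBD, mem_union] at hy ⊢; tauto) h
    · rcases mem_side_or_mem_interior_tri h3 hx with h | h | h | h
      · exact d02 h
      · exact d24 h
      · exact d40 h
      · exact interior_mono (by intro y hy; simp only [regionBD, mem_union] at hy ⊢; tauto) h
    · rcases mem_side_or_mem_interior_tri h4 hx with h | h | h | h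
      · exact d40 (by rwa [segment_symm])
      · exact d46 h
      · exact absurd (s6 h) hxP
      · exact interior_mono (by intro y hy; simp only [regionBD, mem_union] at hy ⊢; tauto) h
    · rcases mem_side_or_mem_interior_tri h5 hx with h | h | h | h
      · exact absurd (s4 h) hxP
      · exact absurd (s5 h) hxP
      · exact d46 (by rwa [segment_symm])
      · exact interior_mono (by intro y hy; simp only [regionBD, mem_union] at hy ⊢; tauto) h
  exact ⟨subset_closedPolygon key.1 key.2.1 key.2.2,
    fun x => mem_openPolygon_of_frontier_subset key.1 key.2.1 key.2.2⟩

lemma regionAC_subset (h1 : 0 < turn (P 0) (P 1) (P 2)) (h2 : 0 < turn (P 2) (P 3) (P 4))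
    (h3 : 0 < turn (P 0) (P 2) (P 4)) (h4 : 0 < turn (P 0) (P 4) (P 5))
    (h5 : 0 < turn (P 0) (P 5) (P 6)) :
    regionAC P ⊆ closedPolygon P ∧ ∀ x ∈ regionAC P, x ∉ P.boundary ℝ → x ∈ openPolygon P := by
  have key : Bornology.IsBounded (regionAC P) ∧ IsClosed (regionAC P) ∧
      ∀ x ∈ regionAC P, x ∉ P.boundary ℝ → x ∈ interior (regionAC P) := by
    refine ⟨?_, ?_, fun x hx hxP => ?_⟩
    · exact (isBounded_tri h1).union ((isBounded_tri h2).union ((isBounded_tri h3).union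
        ((isBounded_tri h4).union (isBounded_tri h5))))
    · exact (isClosed_tri _ _ _).union ((isClosed_tri _ _ _).union ((isClosed_tri _ _ _).union
        ((isClosed_tri _ _ _).union (isClosed_tri _ _ _))))
    obtain ⟨s0, s1, s2, s3, s4, s5, s6⟩ := segment_subset_boundary_heptagon P
    have hv := ne_of_notMem_boundary hxP
    have d02 : x ∈ segment ℝ (P 0) (P 2) → x ∈ interior (regionAC P) := fun h => by
      refine interior_mono ?_ (mem_interior_tri_union_tri (r := P 4) (s := P 1) h3
        (by rwa [← turn_rotate]) h (hv 0) (hv 2))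
      rw [← tri_rotate (P 2)]; intro y hy; simp only [regionAC, mem_union] at hy ⊢; tauto
    have d24 : x ∈ segment ℝ (P 2) (P 4) → x ∈ interior (regionAC P) := fun h => by
      refine interior_mono ?_ (mem_interior_tri_union_tri (r := P 0) (s := P 3)
        (by rwa [turn_rotate]) (by rwa [← turn_rotate]) h (hv 2) (hv 4))
      rw [tri_rotate (P 0), ← tri_rotate (P 4)]; intro y hy; simp only [regionAC, mem_union] at hy ⊢; tauto
    have d40 : x ∈ segment ℝ (P 4) (P 0) → x ∈ interior (regionAC P) := fun h => by
      refine interior_mono ?_ (mem_interior_tri_union_tri (r := P 2) (s := P 5)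
        (by rwa [← turn_rotate]) h4 h (hv 4) (hv 0))
      rw [← tri_rotate (P 4)]; intro y hy; simp only [regionAC, mem_union] at hy ⊢; tauto
    have d05 : x ∈ segment ℝ (P 0) (P 5) → x ∈ interior (regionAC P) := fun h => by
      refine interior_mono ?_ (mem_interior_tri_union_tri (r := P 6) (s := P 4)
        h5 (by rwa [← turn_rotate]) h (hv 0) (hv 5))
      rw [← tri_rotate (P 5)]; intro y hy; simp only [regionAC, mem_union] at hy ⊢; tauto
    rcases hx with hx | hx | hx | hx | hx
    · rcases mem_side_or_mem_interior_tri h1 hx with h | h | h | h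
      · exact absurd (s0 h) hxP
      · exact absurd (s1 h) hxP
      · exact d02 (by rwa [segment_symm])
      · exact interior_mono (by intro y hy; simp only [regionAC, mem_union] at hy ⊢; tauto) h
    · rcases mem_side_or_mem_interior_tri h2 hx with h | h | h | h
      · exact absurd (s2 h) hxP
      · exact absurd (s3 h) hxP
      · exact d24 (by rwa [segment_symm])
      · exact interior_mono (by intro y hy; simp only [regionAC, mem_union] at hy ⊢; tauto) h
    · rcases mem_side_or_mem_interior_tri h3 hx with h | h | h | h
      · exact d02 h
      · exact d24 h
      · exact d40 h
      · exact interior_mono (by intro y hy; simp only [regionAC, mem_union] at hy ⊢; tauto) h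
    · rcases mem_side_or_mem_interior_tri h4 hx with h | h | h | h
      · exact d40 (by rwa [segment_symm])
      · exact absurd (s4 h) hxP
      · exact d05 (by rwa [segment_symm])
      · exact interior_mono (by intro y hy; simp only [regionAC, mem_union] at hy ⊢; tauto) h
    · rcases mem_side_or_mem_interior_tri h5 hx with h | h | h | h
      · exact d05 h
      · exact absurd (s5 h) hxP
      · exact absurd (s6 h) hxP
      · exact interior_mono (by intro y hy; simp only [regionAC, mem_union] at hy ⊢; tauto) h
  exact ⟨subset_closedPolygon key.1 key.2.1 key.2.2,
    fun x => mem_openPolygon_of_frontier_subset key.1 key.2.1 key.2.2⟩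

lemma segment_subset_regionBD
    (h3 : 0 < turn (P 0) (P 2) (P 4)) (h4 : 0 < turn (P 0) (P 4) (P 6)) :
    segment ℝ (P 0) (P 2) ⊆ regionBD P ∧ segment ℝ (P 2) (P 4) ⊆ regionBD P ∧
    segment ℝ (P 4) (P 0) ⊆ regionBD P ∧ segment ℝ (P 4) (P 6) ⊆ regionBD P := by
  refine ⟨(segment_subset_tri h3).trans (by intro y hy; simp only [regionBD, mem_union] at hy ⊢; tauto),
    (segment_subset_tri (r := P 0) (by rwa [turn_rotate])).trans
      (by rw [tri_rotate]; intro y hy; simp only [regionBD, mem_union] at hy ⊢; tauto),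
    (segment_subset_tri (r := P 2) (by rwa [← turn_rotate])).trans
      (by rw [← tri_rotate]; intro y hy; simp only [regionBD, mem_union] at hy ⊢; tauto),
    (segment_subset_tri (r := P 0) (by rwa [turn_rotate])).trans
      (by rw [tri_rotate]; intro y hy; simp only [regionBD, mem_union] at hy ⊢; tauto)⟩

lemma segment_subset_regionAC
    (h3 : 0 < turn (P 0) (P 2) (P 4)) (h5 : 0 < turn (P 0) (P 5) (P 6)) :
    segment ℝ (P 4) (P 0) ⊆ regionAC P ∧ segment ℝ (P 0) (P 5) ⊆ regionAC P := by
  refine ⟨(segment_subset_tri (r := P 2) (by rwa [← turn_rotate])).trans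
      (by rw [← tri_rotate]; intro y hy; simp only [regionAC, mem_union] at hy ⊢; tauto),
    (segment_subset_tri h5).trans (by intro y hy; simp only [regionAC, mem_union] at hy ⊢; tauto)⟩

end

/-! ### Angles around a vertex -/

open EuclideanGeometry Real

/-- The vector `v` points in the direction of `u` turned counterclockwise by the angle `θ`. -/
def IsRotation (u v : Plane) (θ : ℝ) : Prop :=
  u 0 * v 0 + u 1 * v 1 = ‖u‖ * ‖v‖ * cos θ ∧ u 0 * v 1 - u 1 * v 0 = ‖u‖ * ‖v‖ * sin θ

lemma norm_sq_plane (u : Plane) : ‖u‖ ^ 2 = u 0 ^ 2 + u 1 ^ 2 := by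
  simp [EuclideanSpace.norm_sq_eq, Fin.sum_univ_two]

lemma inner_plane (u v : Plane) : inner ℝ u v = u 0 * v 0 + u 1 * v 1 := by
  simp [PiLp.inner_apply, Fin.sum_univ_two]; ring

lemma turn_sq (p q r : Plane) :
    turn q p r ^ 2 = (‖p - q‖ * ‖r - q‖ * sin (∠ p q r)) ^ 2 := by
  have h := InnerProductGeometry.cos_angle_mul_norm_mul_norm (p - q) (r - q)
  have hs := sin_sq_add_cos_sq (∠ p q r)
  have e : ∠ p q r = InnerProductGeometry.angle (p - q) (r - q) := rfl
  rw [← e, inner_plane] at h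
  have h1 := norm_sq_plane (p - q)
  have h2 := norm_sq_plane (r - q)
  have h3 : (‖p - q‖ * ‖r - q‖ * sin (∠ p q r)) ^ 2 =
      ‖p - q‖ ^ 2 * ‖r - q‖ ^ 2 - (cos (∠ p q r) * (‖p - q‖ * ‖r - q‖)) ^ 2 := by
    linear_combination ‖p - q‖ ^ 2 * ‖r - q‖ ^ 2 * hs
  rw [h3, h, h1, h2]
  simp only [turn, PiLp.sub_apply]; ring

lemma isRotation_angle {p q r : Plane} (h : 0 ≤ turn q p r) :
    IsRotation (p - q) (r - q) (∠ p q r) := by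
  constructor
  · rw [← inner_plane, ← InnerProductGeometry.cos_angle_mul_norm_mul_norm, mul_comm]; rfl
  · rw [← (pow_left_inj₀ h (by
      have := sin_nonneg_of_nonneg_of_le_pi (angle_nonneg p q r) (angle_le_pi p q r)
      positivity) two_ne_zero).1 (turn_sq p q r)]
    simp [turn]

/-- These are the addition formulas. They let unoriented angles, each at most π, be summed past π,
with the sum then known modulo 2π. -/
lemma IsRotation.trans {u v w : Plane} {θ φ : ℝ} (hv : v ≠ 0) (h1 : IsRotation u v θ)
    (h2 : IsRotation v w φ) : IsRotation u w (θ + φ) := by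
  obtain ⟨a1, b1⟩ := h1
  obtain ⟨a2, b2⟩ := h2
  have hv' : ‖v‖ ^ 2 ≠ 0 := by simpa using hv
  have e := norm_sq_plane v
  constructor <;> apply mul_left_cancel₀ hv'
  · rw [cos_add]
    linear_combination (u 0 * w 0 + u 1 * w 1) * e + a1 * (v 0 * w 0 + v 1 * w 1) +
      ‖u‖ * ‖v‖ * cos θ * a2 - b1 * (v 0 * w 1 - v 1 * w 0) - ‖u‖ * ‖v‖ * sin θ * b2
  · rw [sin_add]
    linear_combination (u 0 * w 1 - u 1 * w 0) * e + b1 * (v 0 * w 0 + v 1 * w 1) +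
      ‖u‖ * ‖v‖ * sin θ * a2 + a1 * (v 0 * w 1 - v 1 * w 0) + ‖u‖ * ‖v‖ * cos θ * b2

lemma angle_eq_zero_or_pi_of_turn_eq_zero {p q r : Plane} (hp : p ≠ q) (hr : r ≠ q)
    (h : turn p q r = 0) : ∠ p q r = 0 ∨ ∠ p q r = π := by
  have h' : turn q p r = 0 := by unfold turn at h ⊢; linarith
  have h2 := turn_sq p q r
  rw [h'] at h2
  have h3 : ‖p - q‖ * ‖r - q‖ * sin (∠ p q r) = 0 := by
    rw [zero_pow two_ne_zero] at h2
    exact pow_eq_zero_iff two_ne_zero |>.1 h2.symm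
  have h4 : sin (∠ p q r) = 0 := by
    simpa [sub_eq_zero, hp, hr] using h3
  exact sin_eq_zero_iff_angle_eq_zero_or_angle_eq_pi.1 h4

/-! ### Sums of consecutive angles around a vertex -/

section Fan

variable {o p q r s : Plane}

lemma angle_mem_Ioo (h : 0 < turn o p q) : ∠ p o q ∈ Ioo 0 π := by
  have h1 : sin (∠ p o q) ≠ 0 := fun h0 => by
    have := turn_sq p o q
    rw [h0] at this
    simp [h.ne'] at this
  refine ⟨(angle_nonneg _ _ _).lt_of_ne fun h0 => h1 ?_, (angle_le_pi _ _ _).lt_of_ne fun h0 => h1 ?_⟩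
  · rw [← h0, sin_zero]
  · rw [h0, sin_pi]

lemma ne_of_turn_pos (h : 0 < turn o p q) : p - o ≠ 0 ∧ q - o ≠ 0 := by
  rw [sub_ne_zero, sub_ne_zero]
  constructor <;> rintro rfl <;> simp [turn, mul_comm] at h

lemma isRotation_fan_two (h1 : 0 < turn o p q) (h2 : 0 < turn o q r) :
    IsRotation (p - o) (r - o) (∠ p o q + ∠ q o r) :=
  (isRotation_angle h1.le).trans (ne_of_turn_pos h1).2 (isRotation_angle h2.le)

lemma isRotation_fan_three (h1 : 0 < turn o p q) (h2 : 0 < turn o q r) (h3 : 0 < turn o r s) :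
    IsRotation (p - o) (s - o) (∠ p o q + ∠ q o r + ∠ r o s) :=
  (isRotation_fan_two h1 h2).trans (ne_of_turn_pos h2).2 (isRotation_angle h3.le)

lemma angle_eq_pi_of_fan_two (h1 : 0 < turn o p q) (h2 : 0 < turn o q r)
    (h : ∠ p o q + ∠ q o r = π) : ∠ p o r = π := by
  have := (isRotation_fan_two h1 h2).1
  rw [h, cos_pi, ← inner_plane, mul_neg_one] at this
  exact (InnerProductGeometry.inner_eq_neg_mul_norm_iff_angle_eq_pi (ne_of_turn_pos h1).1
    (ne_of_turn_pos h2).2).1 this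

lemma angle_eq_zero_of_fan_three (h1 : 0 < turn o p q) (h2 : 0 < turn o q r)
    (h3 : 0 < turn o r s) (h : ∠ p o q + ∠ q o r + ∠ r o s = 2 * π) : ∠ p o s = 0 := by
  have := (isRotation_fan_three h1 h2 h3).1
  rw [h, cos_two_pi, ← inner_plane, mul_one] at this
  exact (InnerProductGeometry.inner_eq_mul_norm_iff_angle_eq_zero (ne_of_turn_pos h1).1
    (ne_of_turn_pos h3).2).1 this

lemma sin_neg_of_isRotation {θ : ℝ} (h : IsRotation (p - o) (q - o) θ) (h0 : turn o p q < 0) :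
    sin θ < 0 := by
  have h2 : turn o p q = ‖p - o‖ * ‖q - o‖ * sin θ := by
    rw [← h.2]; simp [turn]
  by_contra! hc
  have : 0 ≤ ‖p - o‖ * ‖q - o‖ * sin θ := by positivity
  linarith

/-- The sum has negative sine and is nonnegative, so it cannot be at most π. -/
lemma pi_lt_of_fan_two (h1 : 0 < turn o p q) (h2 : 0 < turn o q r) (h : turn o p r < 0) :
    π < ∠ p o q + ∠ q o r := by
  have hs := sin_neg_of_isRotation (isRotation_fan_two h1 h2) h
  by_contra! hc
  exact hs.not_ge (sin_nonneg_of_nonneg_of_le_pi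
    (add_nonneg (angle_nonneg _ _ _) (angle_nonneg _ _ _)) hc)

/-- The sum is at most 3π, and the sine is nonnegative on [2π, 3π]. -/
lemma fan_three_lt_two_pi (h1 : 0 < turn o p q) (h2 : 0 < turn o q r) (h3 : 0 < turn o r s)
    (h : turn o p s < 0) : ∠ p o q + ∠ q o r + ∠ r o s < 2 * π := by
  have hs := sin_neg_of_isRotation (isRotation_fan_three h1 h2 h3) h
  by_contra! hc
  have := angle_le_pi p o q
  have := angle_le_pi q o r
  have := angle_le_pi r o s
  rw [← sin_sub_two_pi] at hs
  exact hs.not_ge (sin_nonneg_of_nonneg_of_le_pi (by linarith) (by linarith))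

lemma angle_ne_zero_of_pi_le_add (h : π ≤ ∠ p o q + ∠ q o r) (hp : ∠ q p o ≠ 0) :
    ∠ q o r ≠ 0 := fun h0 => by
  have h1 : ∠ p o q = π := le_antisymm (angle_le_pi _ _ _) (by linarith)
  exact hp (by rw [angle_comm]; exact angle_eq_zero_of_angle_eq_pi_left h1)

end Fan

/-- The two triangles have the same height over the line `p r`, so `c` is the ratio of their bases.
-/
lemma turn_of_angle_eq_pi {p q r s : Plane} (h : ∠ p q r = π) :
    ∃ c > 0, turn p q s = c * turn q r s := by
  obtain ⟨⟨t, ⟨h0, h1⟩, hq⟩, -⟩ := sbtw_iff_mem_image_Ioo_and_ne.1 (angle_eq_pi_iff_sbtw.1 h)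
  refine ⟨t / (1 - t), div_pos h0 (by linarith), ?_⟩
  have h2 : 1 - t ≠ 0 := by linarith
  rw [← hq]
  simp only [turn, AffineMap.lineMap_apply, vsub_eq_sub, vadd_eq_add, PiLp.add_apply,
    PiLp.smul_apply, PiLp.sub_apply, smul_eq_mul]
  field_simp
  ring

lemma mem_segment_of_angle_eq_pi {p q r : Plane} (h : ∠ p q r = π) : q ∈ segment ℝ p r :=
  mem_segment_iff_wbtw.2 (angle_eq_pi_iff_sbtw.1 h).wbtw

/-- A simple polygon does not fold back at a vertex. -/
lemma IsSimple.angle_ne_zero {n : ℕ} {P : Polygon Plane n} (hP : IsSimple P) (i : Fin n) :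
    ∠ (P i) (P (finRotate n i)) (P (finRotate n (finRotate n i))) ≠ 0 := by
  intro h
  obtain ⟨m, rfl⟩ : ∃ m, n = m + 3 := ⟨n - 3, by have := hP.three_le; omega⟩
  have hc := hP.consecutive i
  have h1 : finRotate (m + 3) i ≠ i := by simp
  have h2 : finRotate (m + 3) (finRotate (m + 3) i) ≠ finRotate (m + 3) i := by simp
  have key : ∀ x ∈ segment ℝ (P i) (P (finRotate _ i)),
      x ∈ segment ℝ (P (finRotate _ i)) (P (finRotate _ (finRotate _ i))) →
      x = P (finRotate _ i) := by
    intro x hx hx'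
    rw [← affineSegment_eq_segment] at hx hx'
    have : x ∈ P.edgeSet ℝ i ∩ P.edgeSet ℝ (finRotate _ i) := ⟨hx, hx'⟩
    rw [hc] at this
    exact this
  rcases (angle_eq_zero_iff_ne_and_wbtw.1 h) with ⟨-, h⟩ | ⟨-, h⟩
  · refine h1 (hP.injective (key _ (left_mem_segment ℝ _ _) (mem_segment_iff_wbtw.2 h))).symm
  · refine h2 (hP.injective (key _ ?_ (right_mem_segment ℝ _ _)))
    rw [segment_symm]
    exact mem_segment_iff_wbtw.2 h

/-! ### An invariant of monotonic deformations -/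

/-- Quantities whose positivity expresses the following about a heptagon `p 0, …, p 6`: the
quadrilateral `p 0`, `p 4`, `p 5`, `p 6` is strictly convex and the triangles `p 0 p 2 p 4`,
`p 0 p 1 p 2`, `p 2 p 3 p 4` are counterclockwise; at each of the vertices `p 4` and `p 0` the
angle of the middle triangle together with either of its two neighbours exceeds `π`, while the
three together are less than a full turn. -/
noncomputable def margins (p : Fin 7 → Plane) : Fin 13 → ℝ :=
  ![turn (p 0) (p 1) (p 2), turn (p 2) (p 3) (p 4), turn (p 0) (p 2) (p 4),
    turn (p 0) (p 4) (p 5), turn (p 4) (p 5) (p 6), turn (p 5) (p 6) (p 0),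
    turn (p 6) (p 0) (p 4),
    ∠ (p 3) (p 4) (p 2) + ∠ (p 2) (p 4) (p 0) - π,
    ∠ (p 2) (p 4) (p 0) + ∠ (p 0) (p 4) (p 5) - π,
    2 * π - (∠ (p 3) (p 4) (p 2) + ∠ (p 2) (p 4) (p 0) + ∠ (p 0) (p 4) (p 5)),
    ∠ (p 1) (p 0) (p 2) + ∠ (p 2) (p 0) (p 4) - π,
    ∠ (p 2) (p 0) (p 4) + ∠ (p 4) (p 0) (p 6) - π,
    2 * π - (∠ (p 1) (p 0) (p 2) + ∠ (p 2) (p 0) (p 4) + ∠ (p 4) (p 0) (p 6))]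

lemma angle_add_angle_le_pi {p q r : Plane} (h : p ≠ q) : ∠ r p q + ∠ p q r ≤ π := by
  have h1 := angle_add_angle_add_angle_eq_pi r h.symm
  linarith [angle_nonneg q r p]

section

variable {P : Polygon Plane 7}

/-- This is the step that keeps the invariant from failing at a limit: each equality case makes the
polygon fold, makes a forbidden pair visible, or contradicts the angle sum of a triangle. -/
lemma margins_pos_of_nonneg (hP : IsSimple P) (h30 : ¬ Visible P 3 0) (h25 : ¬ Visible P 2 5)
    (h26 : ¬ Visible P 2 6) (h14 : ¬ Visible P 1 4) (h : ∀ i, 0 ≤ margins P i) :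
    ∀ i, 0 < margins P i := by
  have ne : ∀ {i j : Fin 7}, i ≠ j → P i ≠ P j := fun hij => hP.injective.ne hij
  have n012 : ∠ (P 0) (P 1) (P 2) ≠ 0 := hP.angle_ne_zero 0
  have n234 : ∠ (P 2) (P 3) (P 4) ≠ 0 := hP.angle_ne_zero 2
  have n345 : ∠ (P 3) (P 4) (P 5) ≠ 0 := hP.angle_ne_zero 3
  have n456 : ∠ (P 4) (P 5) (P 6) ≠ 0 := hP.angle_ne_zero 4
  have n560 : ∠ (P 5) (P 6) (P 0) ≠ 0 := hP.angle_ne_zero 5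
  have n601 : ∠ (P 6) (P 0) (P 1) ≠ 0 := hP.angle_ne_zero 6
  simp only [margins, Fin.forall_fin_succ, Matrix.cons_val_zero, Matrix.cons_val_succ,
    IsEmpty.forall_iff, and_true, sub_nonneg, sub_pos] at h ⊢
  obtain ⟨h012, h234, h024, h045, h456, h560, h604, b1, b2, b3, a1, a2, a3⟩ := h
  -- If this angle vanished, `b1` would put 4 between 3 and 2, and the polygon would fold at 3.
  have nb : ∠ (P 2) (P 4) (P 0) ≠ 0 := angle_ne_zero_of_pi_le_add b1 n234
  have na : ∠ (P 2) (P 0) (P 4) ≠ 0 :=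
    angle_ne_zero_of_pi_le_add a1 (by rwa [angle_comm])
  have p024 : 0 < turn (P 0) (P 2) (P 4) := by
    refine h024.lt_of_ne' fun h0 => ?_
    rw [← turn_rotate] at h0
    rcases angle_eq_zero_or_pi_of_turn_eq_zero (ne (by decide)) (ne (by decide)) h0 with h1 | h1
    · exact nb h1
    · exact na (by rw [angle_comm]; exact angle_eq_zero_of_angle_eq_pi_right h1)
  have ib : ∠ (P 2) (P 4) (P 0) ∈ Ioo 0 π := by
    rw [angle_comm]; exact angle_mem_Ioo (by rwa [← turn_rotate])
  have ia : ∠ (P 2) (P 0) (P 4) ∈ Ioo 0 π := angle_mem_Ioo p024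
  have ie : ∠ (P 4) (P 2) (P 0) ∈ Ioo 0 π := angle_mem_Ioo (by rwa [turn_rotate])
  have hab : ∠ (P 2) (P 0) (P 4) + ∠ (P 2) (P 4) (P 0) < π := by
    have := angle_add_angle_add_angle_eq_pi (P 2) (ne (show (0 : Fin 7) ≠ 4 by decide))
    rw [angle_comm (P 4) (P 0), angle_comm (P 0) (P 2)] at this
    linarith [ie.1]
  have p234 : 0 < turn (P 2) (P 3) (P 4) := by
    refine h234.lt_of_ne' fun h0 => ?_
    rw [← turn_rotate] at h0
    rcases angle_eq_zero_or_pi_of_turn_eq_zero (ne (by decide)) (ne (by decide)) h0 with h1 | h1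
    · linarith [ib.2]
    · exact n234 (by rw [angle_comm]; exact angle_eq_zero_of_angle_eq_pi_left h1)
  have p012 : 0 < turn (P 0) (P 1) (P 2) := by
    refine h012.lt_of_ne' fun h0 => ?_
    rw [turn_rotate] at h0
    rcases angle_eq_zero_or_pi_of_turn_eq_zero (ne (by decide)) (ne (by decide)) h0 with h1 | h1
    · rw [angle_comm] at h1; linarith [ia.2]
    · exact n012 (angle_eq_zero_of_angle_eq_pi_right h1)
  have p456 : 0 < turn (P 4) (P 5) (P 6) := by
    refine h456.lt_of_ne' fun h0 => ?_
    rcases angle_eq_zero_or_pi_of_turn_eq_zero (ne (by decide)) (ne (by decide)) h0 with h1 | h1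
    · exact n456 h1
    -- With 5 between 4 and 6, the angle 045 is an angle of the triangle 046; but `b2`, `a2` and
    -- `hab` make it exceed π together with the angle 406.
    · have h2 := angle_eq_angle_of_angle_eq_pi (P 0) h1
      have h3 := angle_add_angle_le_pi (r := P 6) (ne (show (0 : Fin 7) ≠ 4 by decide))
      rw [angle_comm (P 6)] at h3
      linarith
  have p560 : 0 < turn (P 5) (P 6) (P 0) := by
    refine h560.lt_of_ne' fun h0 => ?_
    rcases angle_eq_zero_or_pi_of_turn_eq_zero (ne (by decide)) (ne (by decide)) h0 with h1 | h1
    · exact n560 h1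
    · have h2 := angle_eq_angle_of_angle_eq_pi (P 4) ((angle_comm _ _ _).trans h1)
      have h3 := angle_add_angle_le_pi (r := P 5) (ne (show (0 : Fin 7) ≠ 4 by decide))
      rw [angle_comm (P 5)] at h3
      linarith
  have fanB : 0 < turn (P 4) (P 0) (P 2) ∧ 0 < turn (P 4) (P 2) (P 3) :=
    ⟨by rwa [← turn_rotate], by rwa [← turn_rotate]⟩
  have fanA : 0 < turn (P 0) (P 1) (P 2) ∧ 0 < turn (P 0) (P 2) (P 4) := ⟨p012, p024⟩
  have see30 : Visible P 0 4 → ∠ (P 3) (P 4) (P 2) + ∠ (P 2) (P 4) (P 0) ≠ π := fun hv h0 => by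
    rw [add_comm, angle_comm (P 3), angle_comm (P 2)] at h0
    refine h30 ((visible_finRotate P 3).trans_of_mem_segment hv.symm ?_)
    rw [segment_symm]
    exact mem_segment_of_angle_eq_pi (angle_eq_pi_of_fan_two fanB.1 fanB.2 h0)
  have see14 : Visible P 0 4 → ∠ (P 1) (P 0) (P 2) + ∠ (P 2) (P 0) (P 4) ≠ π := fun hv h0 =>
    h14 ((visible_finRotate P 0).symm.trans_of_mem_segment hv
      (mem_segment_of_angle_eq_pi (angle_eq_pi_of_fan_two fanA.1 fanA.2 h0)))
  have p045 : 0 < turn (P 0) (P 4) (P 5) := by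
    refine h045.lt_of_ne' fun h0 => ?_
    rcases angle_eq_zero_or_pi_of_turn_eq_zero (ne (by decide)) (ne (by decide)) h0 with h1 | h1
    · linarith [ib.2]
    -- A straight angle 045 turns `b3` and `b1` into the equality excluded by `see30`. The triangle
    -- 046 is still nondegenerate, so the triangulation with 46 shows that 04 is visible.
    · obtain ⟨c, hc, h2⟩ := turn_of_angle_eq_pi (s := P 6) h1
      have p046 : 0 < turn (P 0) (P 4) (P 6) := by rw [h2]; positivity
      refine see30 ?_ (by linarith)
      rw [Visible, segment_symm]
      exact (segment_subset_regionBD p024 p046).2.2.1.trans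
        (regionBD_subset p012 p234 p024 p046 p456).1
  have p604 : 0 < turn (P 6) (P 0) (P 4) := by
    refine h604.lt_of_ne' fun h0 => ?_
    rcases angle_eq_zero_or_pi_of_turn_eq_zero (ne (by decide)) (ne (by decide)) h0 with h1 | h1
    · rw [angle_comm] at h1; linarith [ia.2]
    -- Here 046 is degenerate, so the visibility of 04 comes from the triangulation with 05; `a3`
    -- and `a1` give the excluded equality.
    · rw [angle_comm] at h1
      refine see14 ?_ (by linarith)
      rw [Visible, segment_symm]
      exact (segment_subset_regionAC p024 (by rwa [← turn_rotate])).1.trans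
        (regionAC_subset p012 p234 p024 p045 (by rwa [← turn_rotate])).1
  have t450 : 0 < turn (P 4) (P 5) (P 0) := by rwa [turn_rotate]
  have p046 : 0 < turn (P 0) (P 4) (P 6) := by rwa [← turn_rotate] at p604
  have hBD := (regionBD_subset p012 p234 p024 p046 p456).1
  obtain ⟨v02, v24, v40, -⟩ := segment_subset_regionBD p024 p046
  have v04 : Visible P 0 4 := Visible.symm (v40.trans hBD)
  have v24' : Visible P 2 4 := v24.trans hBD
  have v20 : Visible P 2 0 := Visible.symm (v02.trans hBD)
  refine ⟨p012, p234, p024, p045, p456, p560, p604, b1.lt_of_ne' (see30 v04),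
    b2.lt_of_ne' fun h0 => ?_, b3.lt_of_ne fun h0 => ?_, a1.lt_of_ne' (see14 v04),
    a2.lt_of_ne' fun h0 => ?_, a3.lt_of_ne fun h0 => ?_⟩
  · rw [add_comm, angle_comm (P 2), angle_comm (P 0)] at h0
    refine h25 (v24'.trans_of_mem_segment (visible_finRotate P 4) ?_)
    rw [segment_symm]
    exact mem_segment_of_angle_eq_pi
      (angle_eq_pi_of_fan_two t450 fanB.1 h0)
  · refine n345 ((angle_comm _ _ _).trans
      (angle_eq_zero_of_fan_three t450 fanB.1 fanB.2 ?_))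
    linarith [angle_comm (P 5) (P 4) (P 0), angle_comm (P 0) (P 4) (P 2),
      angle_comm (P 2) (P 4) (P 3)]
  · refine h26 (v20.trans_of_mem_segment (visible_finRotate P 6).symm ?_)
    exact mem_segment_of_angle_eq_pi (angle_eq_pi_of_fan_two fanA.2 p046 h0)
  · exact n601 ((angle_comm _ _ _).trans (angle_eq_zero_of_fan_three fanA.1 fanA.2 p046 h0))

/-- The strict and the weak inequalities cut out the same set, which is therefore open and closed.
-/
lemma pos_of_pos_of_nonneg {X ι : Type*} [TopologicalSpace X] [PreconnectedSpace X] [Finite ι]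
    {f : X → ι → ℝ} (hf : ∀ i, Continuous fun x => f x i) {x₀ : X} (h₀ : ∀ i, 0 < f x₀ i)
    (h : ∀ x, (∀ i, 0 ≤ f x i) → ∀ i, 0 < f x i) (x : X) : ∀ i, 0 < f x i := by
  have ho : IsOpen {x | ∀ i, 0 < f x i} := by
    simp only [ofPred_forall]
    exact isOpen_iInter_of_finite fun i => isOpen_lt continuous_const (hf i)
  have hc : IsClosed {x | ∀ i, 0 < f x i} := by
    have : {x | ∀ i, 0 < f x i} = ⋂ i, {x | 0 ≤ f x i} := by
      ext x
      simp only [mem_ofPred_eq, mem_iInter]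
      exact ⟨fun hx i => (hx i).le, h x⟩
    rw [this]
    exact isClosed_iInter fun i => isClosed_le continuous_const (hf i)
  have hx : x ∈ {x | ∀ i, 0 < f x i} := IsClopen.eq_univ ⟨hc, ho⟩ ⟨x₀, h₀⟩ ▸ mem_univ x
  exact hx

lemma continuous_margins {X : Type*} [TopologicalSpace X] {p : X → Fin 7 → Plane}
    (hp : ∀ i, Continuous fun x => p x i) (hinj : ∀ x, Function.Injective (p x)) (k : Fin 13) :
    Continuous fun x => margins (p x) k := by
  have ht : ∀ i j k : Fin 7, Continuous fun x => turn (p x i) (p x j) (p x k) := by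
    intro i j k
    unfold turn
    fun_prop
  have ha : ∀ i j k : Fin 7, i ≠ j → k ≠ j →
      Continuous fun x => ∠ (p x i) (p x j) (p x k) := by
    intro i j k hij hkj
    refine continuous_iff_continuousAt.2 fun x => ?_
    exact (continuousAt_angle (x := (p x i, p x j, p x k)) ((hinj x).ne hij)
      ((hinj x).ne hkj)).comp (f := fun x => (p x i, p x j, p x k)) (by fun_prop)
  have a342 := ha 3 4 2 (by decide) (by decide)
  have a240 := ha 2 4 0 (by decide) (by decide)
  have a045 := ha 0 4 5 (by decide) (by decide)
  have a102 := ha 1 0 2 (by decide) (by decide)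
  have a204 := ha 2 0 4 (by decide) (by decide)
  have a406 := ha 4 0 6 (by decide) (by decide)
  fin_cases k
  · exact ht 0 1 2
  · exact ht 2 3 4
  · exact ht 0 2 4
  · exact ht 0 4 5
  · exact ht 4 5 6
  · exact ht 5 6 0
  · exact ht 6 0 4
  · exact (a342.add a240).sub continuous_const
  · exact (a240.add a045).sub continuous_const
  · exact continuous_const.sub ((a342.add a240).add a045)
  · exact (a102.add a204).sub continuous_const
  · exact (a204.add a406).sub continuous_const
  · exact continuous_const.sub ((a102.add a204).add a406)

/-- The diagonals of a strictly convex quadrilateral cross. -/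
lemma not_disjoint_diagonals {a b c d : Plane} (h1 : 0 < turn a b c) (h2 : 0 < turn b c d)
    (h3 : 0 < turn c d a) (h4 : 0 < turn d a b) :
    ¬ Disjoint (openSegment ℝ a c) (openSegment ℝ b d) := by
  rw [not_disjoint_iff]
  have hs : turn b c d + turn d a b = turn a b c + turn c d a := by unfold turn; ring
  have hp : 0 < turn b c d + turn d a b := by positivity
  -- On either diagonal the crossing point weights an endpoint by the area of the triangle on the
  -- other three vertices; both pairs of areas sum to that of the quadrilateral.
  refine ⟨(turn b c d / (turn b c d + turn d a b)) • a +
    (turn d a b / (turn b c d + turn d a b)) • c,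
    ⟨_, _, by positivity, by positivity, by field_simp, rfl⟩,
    ⟨turn c d a / (turn b c d + turn d a b), turn a b c / (turn b c d + turn d a b),
      by positivity, by positivity, by rw [hs]; field_simp; ring, ?_⟩⟩
  ext i
  fin_cases i <;> simp <;> field_simp <;> unfold turn <;> ring

lemma not_isDeflatable (h30 : ¬ Visible P 3 0) (h25 : ¬ Visible P 2 5)
    (h26 : ¬ Visible P 2 6) (h14 : ¬ Visible P 1 4) (h : ∀ i, 0 < margins P i) :
    ¬ IsDeflatable P := by
  rintro ⟨D, hD, hdefl⟩
  have hv : ∀ i j, ¬ Visible P i j → ∀ t, ¬ Visible (D.at_time t) i j := by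
    intro i j hij t ht
    rcases eq_or_ne t 0 with rfl | h0
    · exact hij (by rwa [D.at_zero] at ht)
    · exact hD ⟨i, j, 0, t, unitInterval.pos_iff_ne_zero.2 h0, ht, by rwa [D.at_zero]⟩
  have key := pos_of_pos_of_nonneg (f := fun t => margins (D.at_time t)) (x₀ := 0)
    (continuous_margins D.continuous_vertex fun t => (D.simple t).injective)
    (by simpa only [D.at_zero] using h)
    (fun t => margins_pos_of_nonneg (D.simple t) (hv _ _ h30 t) (hv _ _ h25 t) (hv _ _ h26 t)
      (hv _ _ h14 t)) 1
  simp only [margins, Fin.forall_fin_succ, Matrix.cons_val_zero, Matrix.cons_val_succ,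
    IsEmpty.forall_iff, and_true] at key
  obtain ⟨p012, p234, p024, p045, p456, p560, p604, -⟩ := key
  have p046 : 0 < turn (D.at_time 1 0) (D.at_time 1 4) (D.at_time 1 6) := by rwa [turn_rotate]
  have p056 : 0 < turn (D.at_time 1 0) (D.at_time 1 5) (D.at_time 1 6) := by
    rwa [turn_rotate] at p560
  refine not_disjoint_diagonals p045 p456 p560 p604
    (hdefl 0 5 4 6 (by decide) (by decide) (by decide) ?_ ?_)
  · exact (segment_subset_regionAC p024 p056).2.trans
      (regionAC_subset p012 p234 p024 p045 p056).1
  · exact (segment_subset_regionBD p024 p046).2.2.2.trans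
      (regionBD_subset p012 p234 p024 p046 p456).1

end

/-! ### A polygon that is not deflatable -/

/-- A heptagon that is not deflatable. -/
noncomputable def heptagon : Polygon Plane 7 :=
  ⟨![!₂[-1, 0], !₂[-3, 1], !₂[0, -2], !₂[3, 1], !₂[1, 0], !₂[3, 2], !₂[-3, 2]]⟩

lemma exists_coords_of_mem_segment {p q x : Plane} (h : x ∈ segment ℝ p q) :
    ∃ t : ℝ, 0 ≤ t ∧ t ≤ 1 ∧ x 0 = p 0 + t * (q 0 - p 0) ∧ x 1 = p 1 + t * (q 1 - p 1) := by
  obtain ⟨a, b, ha, hb, hab, rfl⟩ := h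
  obtain rfl : a = 1 - b := by linarith
  refine ⟨b, hb, by linarith, ?_, ?_⟩ <;> simp <;> ring

lemma exists_coords_of_mem_openSegment {p q x : Plane} (h : x ∈ openSegment ℝ p q) :
    ∃ t : ℝ, 0 < t ∧ t < 1 ∧ x 0 = p 0 + t * (q 0 - p 0) ∧ x 1 = p 1 + t * (q 1 - p 1) := by
  obtain ⟨a, b, ha, hb, hab, rfl⟩ := h
  obtain rfl : a = 1 - b := by linarith
  refine ⟨b, hb, by linarith, ?_, ?_⟩ <;> simp <;> ring

/-- The edges of the heptagon in coordinates. -/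
lemma exists_coords_of_mem_edgeSet {x : Plane} {i : Fin 7} (h : x ∈ heptagon.edgeSet ℝ i) :
    ∃ t : ℝ, 0 ≤ t ∧ t ≤ 1 ∧
      x 0 = ![-1 - 2 * t, -3 + 3 * t, 3 * t, 3 - 2 * t, 1 + 2 * t, 3 - 6 * t, -3 + 2 * t] i ∧
      x 1 = ![t, 1 - 3 * t, -2 + 3 * t, 1 - t, 2 * t, 2, 2 - 2 * t] i := by
  rw [Polygon.edgeSet, affineSegment_eq_segment] at h
  obtain ⟨t, h0, h1, hx, hy⟩ := exists_coords_of_mem_segment h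
  refine ⟨t, h0, h1, hx.trans ?_, hy.trans ?_⟩ <;> fin_cases i <;>
    simp [heptagon] <;> ring

lemma isSimple_heptagon : IsSimple heptagon where
  three_le := by norm_num
  injective := by
    intro i j h
    have h0 := congrArg (fun v : Plane => v 0) h
    have h1 := congrArg (fun v : Plane => v 1) h
    fin_cases i <;> fin_cases j <;> first
      | rfl
      | (exfalso; revert h0; simp [heptagon] <;> norm_num; done)
      | (exfalso; revert h1; simp [heptagon])
  consecutive := by
    intro i
    refine Subset.antisymm (fun x hx => ?_) (singleton_subset_iff.2 ⟨?_, ?_⟩)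
    · obtain ⟨s, s0, s1, sx, sy⟩ := exists_coords_of_mem_edgeSet hx.1
      obtain ⟨t, t0, t1, tx, ty⟩ := exists_coords_of_mem_edgeSet hx.2
      have key : x 0 = heptagon (finRotate 7 i) 0 ∧ x 1 = heptagon (finRotate 7 i) 1 := by
        fin_cases i <;> simp [heptagon] at sx sy tx ty ⊢ <;> constructor <;> linarith
      ext k
      fin_cases k
      · exact key.1
      · exact key.2
    · exact right_mem_affineSegment ℝ _ _
    · exact left_mem_affineSegment ℝ _ _
  nonconsecutive := by
    intro i j hij hadj
    rw [Set.disjoint_left]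
    intro x hi hj
    obtain ⟨s, s0, s1, sx, sy⟩ := exists_coords_of_mem_edgeSet hi
    obtain ⟨t, t0, t1, tx, ty⟩ := exists_coords_of_mem_edgeSet hj
    fin_cases i <;> fin_cases j <;> first
      | exact hij rfl
      | exact hadj (.inl rfl)
      | exact hadj (.inr rfl)
      | (simp at sx sy tx ty; linarith)

/-- The points `f k` climb to infinity inside `W`, so `W` lies outside the polygon. The segment from
`i` to `j` enters it already after a tenth of its length. -/
lemma not_visible_heptagon {W : Set Plane} (hW : Convex ℝ W) {f : ℕ → Plane}
    (hf : ∀ k, f k ∈ W) (hfk : ∀ k, f k 1 = k + 1) (hd : Disjoint W (heptagon.boundary ℝ))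
    {i j : Fin 7} (hij : (9 / 10 : ℝ) • heptagon i + (1 / 10 : ℝ) • heptagon j ∈ W) :
    ¬ Visible heptagon i j := by
  intro hv
  have hb : ¬ Bornology.IsBounded W := by
    intro hb
    obtain ⟨C, hC⟩ := hb.exists_norm_le
    obtain ⟨k, hk⟩ := exists_nat_gt C
    have h1 := hC _ (hf k)
    have h2 := PiLp.norm_apply_le (f k) 1
    rw [hfk, norm_of_nonneg (by positivity)] at h2
    linarith
  exact Set.disjoint_left.1 (disjoint_closedPolygon hW.isPreconnected hb hd) hij
    (hv ⟨9 / 10, 1 / 10, by norm_num, by norm_num, by norm_num, rfl⟩)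

/-- The wedge `W` has its apex at vertex 4 and is bounded by the rays along the edges to 3 and 5;
the points `f k` lie on a ray of slope 2/3 inside it. The hypotheses are membership in `W`,
multiplied by ten. -/
lemma not_visible_right {i j : Fin 7}
    (h1 : (9 * heptagon i 1 + heptagon j 1) < 9 * heptagon i 0 + heptagon j 0 - 10)
    (h2 : 9 * heptagon i 0 + heptagon j 0 - 10 < 2 * (9 * heptagon i 1 + heptagon j 1)) :
    ¬ Visible heptagon i j := by
  refine not_visible_heptagon (W := {x | x 1 < x 0 - 1 ∧ x 0 - 1 < 2 * x 1})
    (f := fun k => !₂[3 / 2 * (k + 1) + 1, (k : ℝ) + 1]) ?_ ?_ ?_ ?_ ?_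
  · rintro x ⟨hx1, hx2⟩ y ⟨hy1, hy2⟩ a b ha hb hab
    obtain rfl : b = 1 - a := by linarith
    simp only [mem_ofPred_eq, PiLp.add_apply, PiLp.smul_apply, smul_eq_mul]
    rcases ha.eq_or_lt with rfl | ha
    · constructor <;> linarith
    · constructor <;> nlinarith
  · intro k
    have : (0 : ℝ) ≤ k := k.cast_nonneg
    constructor <;> simp <;> linarith
  · intro k; simp
  · rw [Set.disjoint_left]
    rintro x ⟨hx1, hx2⟩ hx
    obtain ⟨i, hi⟩ := mem_iUnion.1 hx
    obtain ⟨t, t0, t1, tx, ty⟩ := exists_coords_of_mem_edgeSet hi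
    fin_cases i <;> simp at tx ty <;> linarith
  · simp only [mem_ofPred_eq, PiLp.add_apply, PiLp.smul_apply, smul_eq_mul]
    constructor <;> linarith

/-- This is the mirror image, with the wedge at vertex 0 between the edges to 1 and 6. -/
lemma not_visible_left {i j : Fin 7}
    (h1 : (9 * heptagon i 1 + heptagon j 1) < - (9 * heptagon i 0 + heptagon j 0) - 10)
    (h2 : - (9 * heptagon i 0 + heptagon j 0) - 10 < 2 * (9 * heptagon i 1 + heptagon j 1)) :
    ¬ Visible heptagon i j := by
  refine not_visible_heptagon (W := {x | x 1 < - x 0 - 1 ∧ - x 0 - 1 < 2 * x 1})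
    (f := fun k => !₂[- (3 / 2 * (k + 1) + 1), (k : ℝ) + 1]) ?_ ?_ ?_ ?_ ?_
  · rintro x ⟨hx1, hx2⟩ y ⟨hy1, hy2⟩ a b ha hb hab
    obtain rfl : b = 1 - a := by linarith
    simp only [mem_ofPred_eq, PiLp.add_apply, PiLp.smul_apply, smul_eq_mul]
    rcases ha.eq_or_lt with rfl | ha
    · constructor <;> linarith
    · constructor <;> nlinarith
  · intro k
    have : (0 : ℝ) ≤ k := k.cast_nonneg
    constructor <;> simp <;> linarith
  · intro k; simp
  · rw [Set.disjoint_left]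
    rintro x ⟨hx1, hx2⟩ hx
    obtain ⟨i, hi⟩ := mem_iUnion.1 hx
    obtain ⟨t, t0, t1, tx, ty⟩ := exists_coords_of_mem_edgeSet hi
    fin_cases i <;> simp at tx ty <;> linarith
  · simp only [mem_ofPred_eq, PiLp.add_apply, PiLp.smul_apply, smul_eq_mul]
    constructor <;> linarith

lemma turn_heptagon :
    0 < turn (heptagon 0) (heptagon 1) (heptagon 2) ∧
    0 < turn (heptagon 2) (heptagon 3) (heptagon 4) ∧
    0 < turn (heptagon 0) (heptagon 2) (heptagon 4) ∧
    0 < turn (heptagon 0) (heptagon 4) (heptagon 5) ∧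
    0 < turn (heptagon 4) (heptagon 5) (heptagon 6) ∧
    0 < turn (heptagon 5) (heptagon 6) (heptagon 0) ∧
    0 < turn (heptagon 6) (heptagon 0) (heptagon 4) := by
  refine ⟨?_, ?_, ?_, ?_, ?_, ?_, ?_⟩ <;> simp [turn, heptagon] <;> norm_num

lemma notMem_boundary_heptagon {x : Plane} (h : ∀ i, x ∉ heptagon.edgeSet ℝ i) :
    x ∉ heptagon.boundary ℝ := by
  simpa [Polygon.boundary] using h

lemma openSegment_subset_heptagon :
    openSegment ℝ (heptagon 0) (heptagon 2) ⊆ openPolygon heptagon ∧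
    openSegment ℝ (heptagon 2) (heptagon 4) ⊆ openPolygon heptagon ∧
    openSegment ℝ (heptagon 0) (heptagon 4) ⊆ openPolygon heptagon ∧
    openSegment ℝ (heptagon 4) (heptagon 6) ⊆ openPolygon heptagon ∧
    openSegment ℝ (heptagon 0) (heptagon 5) ⊆ openPolygon heptagon := by
  obtain ⟨p012, p234, p024, p045, p456, p560, p604⟩ := turn_heptagon
  have p046 : 0 < turn (heptagon 0) (heptagon 4) (heptagon 6) := by rwa [← turn_rotate] at p604
  have p056 : 0 < turn (heptagon 0) (heptagon 5) (heptagon 6) := by rwa [← turn_rotate]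
  have hBD := (regionBD_subset p012 p234 p024 p046 p456).2
  have hAC := (regionAC_subset p012 p234 p024 p045 p056).2
  obtain ⟨s02, s24, s40, s46⟩ := segment_subset_regionBD p024 p046
  have s05 := (segment_subset_regionAC p024 p056).2
  rw [segment_symm] at s40
  refine ⟨fun x hx => hBD x (s02 (openSegment_subset_segment ℝ _ _ hx)) ?_,
    fun x hx => hBD x (s24 (openSegment_subset_segment ℝ _ _ hx)) ?_,
    fun x hx => hBD x (s40 (openSegment_subset_segment ℝ _ _ hx)) ?_,
    fun x hx => hBD x (s46 (openSegment_subset_segment ℝ _ _ hx)) ?_,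
    fun x hx => hAC x (s05 (openSegment_subset_segment ℝ _ _ hx)) ?_⟩ <;>
  · obtain ⟨s, s0, s1, sx, sy⟩ := exists_coords_of_mem_openSegment hx
    refine notMem_boundary_heptagon fun i hi => ?_
    obtain ⟨t, t0, t1, tx, ty⟩ := exists_coords_of_mem_edgeSet hi
    simp [heptagon] at sx sy
    fin_cases i <;> simp at tx ty <;> linarith

lemma not_visible_pairs_heptagon :
    ¬ Visible heptagon 3 0 ∧ ¬ Visible heptagon 3 5 ∧ ¬ Visible heptagon 3 6 ∧
    ¬ Visible heptagon 3 1 ∧ ¬ Visible heptagon 5 2 ∧ ¬ Visible heptagon 1 4 ∧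
    ¬ Visible heptagon 1 5 ∧ ¬ Visible heptagon 1 6 ∧ ¬ Visible heptagon 6 2 := by
  refine ⟨not_visible_right ?_ ?_, not_visible_right ?_ ?_, not_visible_right ?_ ?_,
    not_visible_right ?_ ?_, not_visible_right ?_ ?_, not_visible_left ?_ ?_,
    not_visible_left ?_ ?_, not_visible_left ?_ ?_, not_visible_left ?_ ?_⟩ <;>
    simp [heptagon] <;> norm_num

lemma inGeneralPosition_heptagon : InGeneralPosition heptagon := by
  intro i j hij hadj hv
  wlog h : i < j generalizing i j
  · rw [openSegment_symm]
    exact this j i hij.symm (fun h => hadj h.symm) hv.symm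
      (lt_of_le_of_ne (not_lt.1 h) hij.symm)
  obtain ⟨s02, s24, s04, s46, s05⟩ := openSegment_subset_heptagon
  obtain ⟨n30, n35, n36, n31, n52, n14, n15, n16, n62⟩ := not_visible_pairs_heptagon
  -- Of the 14 non-adjacent pairs, five run through the open polygon and nine are invisible.
  fin_cases i <;> fin_cases j <;> first
    | exact absurd h (by decide)
    | exact absurd (.inl rfl) hadj
    | exact absurd (.inr rfl) hadj
    | exact s02
    | exact s24
    | exact s04
    | exact s46
    | exact s05
    | exact absurd hv.symm n30
    | exact absurd hv n35
    | exact absurd hv n36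
    | exact absurd hv.symm n31
    | exact absurd hv.symm n52
    | exact absurd hv n14
    | exact absurd hv n15
    | exact absurd hv n16
    | exact absurd hv.symm n62

lemma margins_heptagon_pos : ∀ i, 0 < margins heptagon i := by
  obtain ⟨p012, p234, p024, p045, p456, p560, p604⟩ := turn_heptagon
  have t450 : 0 < turn (heptagon 4) (heptagon 5) (heptagon 0) := by rwa [turn_rotate]
  have t402 : 0 < turn (heptagon 4) (heptagon 0) (heptagon 2) := by rwa [← turn_rotate]
  have t423 : 0 < turn (heptagon 4) (heptagon 2) (heptagon 3) := by rwa [← turn_rotate]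
  have p046 : 0 < turn (heptagon 0) (heptagon 4) (heptagon 6) := by rwa [← turn_rotate] at p604
  have b1 := pi_lt_of_fan_two t402 t423 (by simp [turn, heptagon])
  have b2 := pi_lt_of_fan_two t450 t402 (by simp [turn, heptagon]; norm_num)
  have b3 := fan_three_lt_two_pi t450 t402 t423 (by simp [turn, heptagon])
  have a1 := pi_lt_of_fan_two p012 p024 (by simp [turn, heptagon])
  have a2 := pi_lt_of_fan_two p024 p046 (by simp [turn, heptagon]; norm_num)
  have a3 := fan_three_lt_two_pi p012 p024 p046 (by simp [turn, heptagon]; norm_num)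
  have e1 := angle_comm (heptagon 3) (heptagon 4) (heptagon 2)
  have e2 := angle_comm (heptagon 2) (heptagon 4) (heptagon 0)
  have e3 := angle_comm (heptagon 0) (heptagon 4) (heptagon 5)
  simp only [margins, Fin.forall_fin_succ, Matrix.cons_val_zero, Matrix.cons_val_succ,
    IsEmpty.forall_iff, and_true, sub_pos]
  exact ⟨p012, p234, p024, p045, p456, p560, p604, by linarith, by linarith, by linarith,
    by linarith, by linarith, by linarith⟩

lemma not_isDeflatable_heptagon : ¬ IsDeflatable heptagon := by
  obtain ⟨n30, -, -, -, n52, n14, -, -, n62⟩ := not_visible_pairs_heptagon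
  exact not_isDeflatable n30 (fun h => n52 h.symm) (fun h => n62 h.symm) n14 margins_heptagon_pos

end PolygonDeflation

theorem mainTheorem1 :
    ∃ (n : ℕ) (P : Polygon PolygonDeflation.Plane n),
      PolygonDeflation.IsSimple P ∧ PolygonDeflation.InGeneralPosition P ∧
        ¬ PolygonDeflation.IsDeflatable P :=
  ⟨7, PolygonDeflation.heptagon, PolygonDeflation.isSimple_heptagon,
    PolygonDeflation.inGeneralPosition_heptagon, PolygonDeflation.not_isDeflatable_heptagon⟩
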